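/- Let $k,m\ge 1$ and identify $M_k\otimes M_m$ with $M_{km}$ (complex matrices) via the Kronecker product. A matrix $A\in M_k\otimes M_m$ is PPT if $A$ and its partial transpose $A^{t_1}=((\cdot)^t\otimes \mathrm{Id})(A)$ are both positive semidefinite Hermitian. A Hermitian Schmidt decomposition of $A$ is an expression $A=\sum_{i=1}^n\lambda_i\,\gamma_i\otimes\delta_i$ with real $\lambda_i>0$ and Hermitian $\gamma_i\in M_k$, $\delta_i\in M_m$ such that $(\gamma_i)_i$ and $(\delta_i)_i$ are orthonormal families for the inner product $\langle C,D\rangle=\mathrm{tr}(CD^*)$. **Theorem (Split decomposition for PPT matrices).** Let $A\in M_k\otimes M_m$ be PPT, and let $A=\sum_{i=1}^n\lambda_i\gamma_i\otimes\delta_i$ be a Hermitian Schmidt decomposition with $\lambda_1=\dots=\lambda_s>\lambda_{s+1}\ge\dots\ge\lambda_n>0$, where $1\le s\le n$ (if $s=n$ the condition reads $\lambda_1=\dots=\lambda_n>0$). Let $D=\sum_{i=1}^s\gamma_i\otimes\delta_i$. (a) There is a Hermitian Schmidt decomposition $D=\sum_{i=1}^s\gamma_i'\otimes\delta_i'$ such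 that $\gamma_i'$ and $\delta_i'$ are positive semidefinite for $1\le i\le s$. It is unique up to the order of its terms: if $D=\sum_{j=1}^r\mu_j\alpha_j\otimes\beta_j$ is any Hermitian Schmidt decomposition with all $\alpha_j,\beta_j$ positive semidefinite, then $r=s$, all $\mu_j=1$, and there is a permutation $\sigma$ of $\{1,\dots,s\}$ with $\alpha_j=\gamma'_{\sigma(j)}$ and $\beta_j=\delta'_{\sigma(j)}$ for all $j$. (b) The sums $\sum_{i\le s}\mathrm{Im}(\gamma_i')$ and $\sum_{i\le s}\mathrm{Im}(\delta_i')$ are direct. For $1\le i\le s$ let $V_i\in M_k$ and $W_i\in M_m$ be the orthogonal projections onto $\mathrm{Im}(\gamma_i')$ and $\mathrm{Im}(\delta_i')$, and let $V_{s+1}$, $W_{s+1}$ be the orthogonal projections onto $(\mathrm{Im}(\gamma_1')\oplus\dots\oplus\mathrm{Im}(\gamma_s'))^{\perp}$ and $(\mathrm{Im}(\delta_1')\oplus\dots\oplus\mathrm{Im}(\delta_s'))^{\perp}$. Then $$A=\sum_{i=1}^{s+1}(V_i\otimes W_i)\,A\,(V_i\otimes W_i),$$ and $(V_i\otimes W_i)A(V_i\otimes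 W_i)$ is PPT for every $1\le i\le s+1$. -/

import Mathlib

open Matrix
open scoped Kronecker ComplexOrder

/-- Partial transposition on the first tensor factor, `A ↦ A^{t₁} = ((·)ᵗ ⊗ Id)(A)`; the space
`M_k ⊗ M_m` is identified with `M_{km}` (rows and columns indexed by `Fin k × Fin m`) through the
Kronecker product. -/
def partialTranspose {k m : ℕ} (A : Matrix (Fin k × Fin m) (Fin k × Fin m) ℂ) :
    Matrix (Fin k × Fin m) (Fin k × Fin m) ℂ :=
  Matrix.of fun p q => A (q.1, p.2) (p.1, q.2)

/-- `(∑ Aᵢ ⊗ Bᵢ)^{t₁} = ∑ Aᵢᵗ ⊗ Bᵢ`. -/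
theorem partialTranspose_sum_kronecker {k m : ℕ} {ι : Type*} (s : Finset ι)
    (A : ι → Matrix (Fin k) (Fin k) ℂ) (B : ι → Matrix (Fin m) (Fin m) ℂ) :
    partialTranspose (∑ i ∈ s, A i ⊗ₖ B i) = ∑ i ∈ s, (A i)ᵀ ⊗ₖ B i := by
  ext p q
  simp [partialTranspose, Matrix.sum_apply, Matrix.kroneckerMap_apply]

/-- Positive under partial transposition (PPT). -/
def IsPPT {k m : ℕ} (A : Matrix (Fin k × Fin m) (Fin k × Fin m) ℂ) : Prop :=
  A.PosSemidef ∧ (partialTranspose A).PosSemidef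

/-- A finite family of matrices is orthonormal for the inner product `⟨C, D⟩ = tr (C D*)`. -/
def TraceOrthonormal {k n : ℕ} (γ : Fin n → Matrix (Fin k) (Fin k) ℂ) : Prop :=
  ∀ i j, (γ i * (γ j)ᴴ).trace = if i = j then 1 else 0

/-- `A = ∑ᵢ lamᵢ γᵢ ⊗ δᵢ` is a Hermitian Schmidt decomposition of `A`. -/
structure IsHermitianSchmidt {k m n : ℕ} (A : Matrix (Fin k × Fin m) (Fin k × Fin m) ℂ)
    (lam : Fin n → ℝ) (γ : Fin n → Matrix (Fin k) (Fin k) ℂ)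
    (δ : Fin n → Matrix (Fin m) (Fin m) ℂ) : Prop where
  lam_pos : ∀ i, 0 < lam i
  left_hermitian : ∀ i, (γ i).IsHermitian
  right_hermitian : ∀ i, (δ i).IsHermitian
  left_orthonormal : TraceOrthonormal γ
  right_orthonormal : TraceOrthonormal δ
  eq_sum : A = ∑ i, (lam i : ℂ) • (γ i ⊗ₖ δ i)

/-- The image of a square matrix acting on column vectors of `ℂᵏ`. -/
noncomputable def matrixImage {k : ℕ} (X : Matrix (Fin k) (Fin k) ℂ) :
    Submodule ℂ (EuclideanSpace ℂ (Fin k)) :=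
  LinearMap.range (Matrix.toEuclideanLin X)

/-- The matrix of the orthogonal projection of `ℂᵏ` onto the subspace `U`. -/
noncomputable def projMatrix {k : ℕ} (U : Submodule ℂ (EuclideanSpace ℂ (Fin k))) :
    Matrix (Fin k) (Fin k) ℂ :=
  Matrix.toEuclideanLin.symm (U.starProjection : EuclideanSpace ℂ (Fin k) →ₗ[ℂ] _)

/-- The projections `V₁, …, V_{s+1}` attached to `X₁, …, X_s`: for `i ≤ s`, `Vᵢ` is the orthogonal
projection onto `Im Xᵢ`, and `V_{s+1}` is the orthogonal projection onto
`(Im X₁ + ⋯ + Im X_s)ᗮ`. -/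
noncomputable def splitProj {k s : ℕ} (X : Fin s → Matrix (Fin k) (Fin k) ℂ) :
    Fin (s + 1) → Matrix (Fin k) (Fin k) ℂ :=
  Fin.snoc (α := fun _ => Matrix (Fin k) (Fin k) ℂ)
    (fun i => projMatrix (matrixImage (X i))) (projMatrix (⨆ i, matrixImage (X i))ᗮ)

/-!
Let `L` be the largest Schmidt coefficient and `(γᵢ)`, `(δᵢ)`, `i ≤ s`, the corresponding Hermitian
families; for `x ∈ ℝˢ` write `γ(x) = ∑ xᵢ γᵢ` and `δ(x) = ∑ xᵢ δᵢ`. The bilinear form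
`(X, Y) ↦ tr (A (X ⊗ Y))` on Hermitian matrices satisfies
`2 tr (A (X ⊗ Y)) ≤ L (‖X‖² + ‖Y‖²)`, with equality exactly for the pairs `(γ(x), δ(x))`
(`IsHermitianSchmidt.isTopSchmidt`). Everything rests on this extremal property.

*Jordan decomposition.* Replacing `(X, Y)` by `(|X|, |Y|)` keeps the norms and, as `A ≥ 0`, does
not decrease the form. So the positive parts of `γ(x)` and `δ(x)` form again a pair
`(γ(p), δ(p))`, and similarly for the negative parts (`IsTopSchmidt.exists_sub_isPosPair`).

*Splitting.* Let `γ(x)`, `δ(x)` be positive semidefinite, with support projections `V`, `W`.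
Positivity of `A` forces `A ((1 - V) ⊗ W) = 0` and `A (V ⊗ (1 - W)) = 0`, and positivity of the
partial transpose kills the remaining off-diagonal block `(V ⊗ W) A ((1 - V) ⊗ (1 - W))`
(`IsPPT.splits`). Hence `A` commutes with `V ⊗ 1`, and `A (V ⊗ 1) = A (1 ⊗ W)`. It follows that `V`
commutes with every `γ(z)`, and that the compression of a pair by `(V, W)` is again extremal
(`IsTopSchmidt.exists_mul_eq_realComb`).

*Existence.* Among the sets of nonzero pairwise orthogonal `x` with `γ(x)`, `δ(x)` positive
semidefinite, one that does not span `ℝˢ` can be enlarged by one element: a vector orthogonal to it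
is compressed to the supports of the members, and Jordan decomposition of the result yields new
positive elements (`IsTopSchmidt.exists_isPosOrthogonal_succ`). So `ℝˢ` has an orthonormal basis
`u` of such vectors, and `γ'ᵢ = γ(uᵢ)`, `δ'ᵢ = δ(uᵢ)`. Positive semidefinite matrices that are
orthogonal for the trace have product zero, so the images are pairwise orthogonal.

*Uniqueness.* Two such decompositions are related by an orthogonal matrix with nonnegative entries,
which is a permutation matrix (`IsHermitianSchmidt.exists_equiv_of_posSemidef`).

*Decomposition of `A`.* The relations expressing that `A` is split by `(V, W)` are linear in the
pair, so they pass from the `(Vᵢ, Wᵢ)`, `i ≤ s`, to the complementary pair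
`(1 - ∑ Vᵢ, 1 - ∑ Wᵢ)`. They give `(Vᵢ ⊗ Wᵢ) A (Vᵢ ⊗ Wᵢ) = A (Vᵢ ⊗ 1)` for all `i ≤ s + 1`, and
these terms add up to `A`.
-/

/-! ### Positive semidefinite matrices and the trace pairing -/

section Trace

variable {ι : Type*} [Fintype ι]

theorem Matrix.PosSemidef.exists_conjTranspose_mul_self [DecidableEq ι] {P : Matrix ι ι ℂ}
    (hP : P.PosSemidef) : ∃ C : Matrix ι ι ℂ, P = Cᴴ * C := by
  open scoped MatrixOrder in
  exact CStarAlgebra.nonneg_iff_eq_star_mul_self.mp hP.nonneg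

theorem Matrix.PosSemidef.trace_mul_nonneg {P Q : Matrix ι ι ℂ} (hP : P.PosSemidef)
    (hQ : Q.PosSemidef) : 0 ≤ (P * Q).trace := by
  classical
  obtain ⟨C, rfl⟩ := hP.exists_conjTranspose_mul_self
  rw [Matrix.mul_assoc, trace_mul_comm]
  exact (hQ.mul_mul_conjTranspose_same C).trace_nonneg

theorem Matrix.PosSemidef.mul_eq_zero_of_trace {P Q : Matrix ι ι ℂ} (hP : P.PosSemidef)
    (hQ : Q.PosSemidef) (h : (P * Q).trace = 0) : P * Q = 0 := by
  classical
  obtain ⟨C, rfl⟩ := hP.exists_conjTranspose_mul_self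
  obtain ⟨B, rfl⟩ := hQ.exists_conjTranspose_mul_self
  have h' : ((B * Cᴴ)ᴴ * (B * Cᴴ)).trace = 0 := by
    rw [← h, conjTranspose_mul, conjTranspose_conjTranspose, ← Matrix.mul_assoc, trace_mul_comm]
    simp only [Matrix.mul_assoc]
  have h0 := trace_conjTranspose_mul_self_eq_zero_iff.mp h'
  have h1 : C * Bᴴ = 0 := by
    rw [← conjTranspose_eq_zero, conjTranspose_mul, conjTranspose_conjTranspose, h0]
  calc Cᴴ * C * (Bᴴ * B) = Cᴴ * (C * Bᴴ) * B := by simp only [Matrix.mul_assoc]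
    _ = 0 := by simp [h1]

theorem Matrix.IsHermitian.exists_sub_posSemidef [DecidableEq ι] {X : Matrix ι ι ℂ}
    (hX : X.IsHermitian) :
    ∃ P N : Matrix ι ι ℂ, P.PosSemidef ∧ N.PosSemidef ∧ X = P - N ∧ P * N = 0 := by
  open scoped MatrixOrder in
  exact ⟨X⁺, X⁻, (CFC.posPart_nonneg X).posSemidef, (CFC.negPart_nonneg X).posSemidef,
    (CFC.posPart_sub_negPart X hX.isSelfAdjoint).symm, CFC.posPart_mul_negPart X⟩

theorem Matrix.IsHermitian.ofReal_re_trace_mul {X Y : Matrix ι ι ℂ} (hX : X.IsHermitian)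
    (hY : Y.IsHermitian) : (((X * Y).trace.re : ℝ) : ℂ) = (X * Y).trace := by
  have : star (X * Y).trace = (X * Y).trace := by
    rw [← trace_conjTranspose, conjTranspose_mul, hX.eq, hY.eq, trace_mul_comm]
  exact Complex.conj_eq_iff_re.mp this

theorem Matrix.IsHermitian.re_trace_mul_self_nonneg {X : Matrix ι ι ℂ} (hX : X.IsHermitian) :
    0 ≤ (X * X).trace.re := by
  have := (posSemidef_conjTranspose_mul_self X).trace_nonneg
  rw [hX.eq] at this
  exact (Complex.le_def.mp this).1

theorem Matrix.IsHermitian.eq_zero_of_re_trace_mul_self {X : Matrix ι ι ℂ} (hX : X.IsHermitian)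
    (h : (X * X).trace.re = 0) : X = 0 := by
  rw [← trace_conjTranspose_mul_self_eq_zero_iff, hX.eq, ← hX.ofReal_re_trace_mul hX, h]
  simp

end Trace

/-! ### Projections onto images -/

section Projections

variable {k : ℕ}

theorem toEuclideanLin_mul (X Y : Matrix (Fin k) (Fin k) ℂ) :
    (X * Y).toEuclideanLin = X.toEuclideanLin ∘ₗ Y.toEuclideanLin := by
  ext v : 1
  simp

theorem toEuclideanLin_projMatrix (U : Submodule ℂ (EuclideanSpace ℂ (Fin k))) :
    (projMatrix U).toEuclideanLin = (U.starProjection : _ →ₗ[ℂ] _) :=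
  LinearEquiv.apply_symm_apply _ _

theorem projMatrix_isHermitian (U : Submodule ℂ (EuclideanSpace ℂ (Fin k))) :
    (projMatrix U).IsHermitian := by
  rw [← isSymmetric_toEuclideanLin_iff, toEuclideanLin_projMatrix]
  exact U.starProjection_isSymmetric

theorem projMatrix_mul_self (U : Submodule ℂ (EuclideanSpace ℂ (Fin k))) :
    projMatrix U * projMatrix U = projMatrix U := by
  apply toEuclideanLin.injective
  rw [toEuclideanLin_mul, toEuclideanLin_projMatrix]
  ext v : 1
  exact U.starProjection_eq_self_iff.mpr (U.starProjection_apply_mem v)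

theorem projMatrix_image_mul (X : Matrix (Fin k) (Fin k) ℂ) :
    projMatrix (matrixImage X) * X = X := by
  apply toEuclideanLin.injective
  rw [toEuclideanLin_mul, toEuclideanLin_projMatrix]
  ext v : 1
  exact (matrixImage X).starProjection_eq_self_iff.mpr (LinearMap.mem_range_self _ v)

/-- The projection onto `Im X` factors through `X`, so that whatever is annihilated by
multiplication with `X` is annihilated by multiplication with the projection. -/
theorem exists_projMatrix_image_eq_mul (X : Matrix (Fin k) (Fin k) ℂ) :
    ∃ Z, projMatrix (matrixImage X) = X * Z := by
  obtain ⟨g, hg⟩ := Module.projective_lifting_property X.toEuclideanLin.rangeRestrict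
    ((matrixImage X).orthogonalProjectionOnto :
      EuclideanSpace ℂ (Fin k) →ₗ[ℂ] matrixImage X)
    (LinearMap.surjective_rangeRestrict _)
  refine ⟨toEuclideanLin.symm g, toEuclideanLin.injective ?_⟩
  rw [toEuclideanLin_mul, toEuclideanLin_projMatrix, LinearEquiv.apply_symm_apply]
  ext v : 1
  exact (congrArg Subtype.val (LinearMap.congr_fun hg v)).symm

theorem isOrtho_matrixImage {X Y : Matrix (Fin k) (Fin k) ℂ} (hX : X.IsHermitian)
    (h : X * Y = 0) : matrixImage X ⟂ matrixImage Y := by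
  rw [Submodule.isOrtho_iff_inner_eq]
  rintro _ ⟨u, rfl⟩ _ ⟨v, rfl⟩
  rw [(isSymmetric_toEuclideanLin_iff.mpr hX) u, ← LinearMap.comp_apply, ← toEuclideanLin_mul, h]
  simp

theorem iSupIndep_matrixImage {s : ℕ} {X : Fin s → Matrix (Fin k) (Fin k) ℂ}
    (hX : ∀ i, (X i).IsHermitian) (h : ∀ i j, i ≠ j → X i * X j = 0) :
    iSupIndep fun i => matrixImage (X i) :=
  (OrthogonalFamily.of_pairwise fun i j hij => isOrtho_matrixImage (hX i) (h i j hij)).independent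

/-- For pairwise orthogonal images, the projection onto the complement of their sum. -/
theorem projMatrix_iSup_orthogonal {s : ℕ} {X : Fin s → Matrix (Fin k) (Fin k) ℂ}
    (hX : ∀ i, (X i).IsHermitian) (h : ∀ i j, i ≠ j → X i * X j = 0) :
    projMatrix (⨆ i, matrixImage (X i))ᗮ = 1 - ∑ i, projMatrix (matrixImage (X i)) := by
  apply toEuclideanLin.injective
  rw [map_sub, map_sum]
  simp only [toEuclideanLin_projMatrix]
  ext1 v
  have key : (⨆ i, matrixImage (X i)).starProjection v =
      ∑ i, (matrixImage (X i)).starProjection v := by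
    refine Submodule.eq_starProjection_of_mem_of_inner_eq_zero
      (Submodule.sum_mem _ fun i _ => Submodule.mem_iSup_of_mem i
        ((matrixImage (X i)).starProjection_apply_mem v)) fun w hw => ?_
    induction hw using Submodule.iSup_induction' with
    | mem j w hw =>
      rw [inner_sub_left, sum_inner, Finset.sum_eq_single j, ← inner_sub_left]
      · exact (Submodule.mem_orthogonal' _ _).mp
          ((matrixImage (X j)).sub_starProjection_mem_orthogonal v) w hw
      · intro i _ hij
        exact (isOrtho_matrixImage (hX i) (h i j hij)).inner_eq
          ((matrixImage (X i)).starProjection_apply_mem v) hw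
      · simp
    | zero => simp
    | add x y _ _ hx hy => rw [inner_add_right, hx, hy, add_zero]
  simp [Submodule.starProjection_orthogonal, key, LinearMap.sum_apply]

end Projections

/-! ### Partial transposition -/

section PartialTranspose

variable {k m : ℕ}

/-- Multiplication by elementary tensors under partial transposition: the factors on the first leg
are transposed and change sides. -/
theorem partialTranspose_kronecker_mul_mul (A : Matrix (Fin k × Fin m) (Fin k × Fin m) ℂ)
    (P R : Matrix (Fin k) (Fin k) ℂ) (Q S : Matrix (Fin m) (Fin m) ℂ) :
    partialTranspose ((P ⊗ₖ Q) * A * (R ⊗ₖ S)) =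
      (Rᵀ ⊗ₖ Q) * partialTranspose A * (Pᵀ ⊗ₖ S) := by
  ext ⟨a, b⟩ ⟨c, d⟩
  simp only [partialTranspose, of_apply, mul_apply, Fintype.sum_prod_type, kroneckerMap_apply,
    transpose_apply, Finset.sum_mul]
  refine (Finset.sum_congr rfl fun x _ => Finset.sum_comm).trans
    (Finset.sum_comm.trans (Finset.sum_congr rfl fun x _ => Finset.sum_comm.trans ?_))
  refine Finset.sum_congr rfl fun y _ => Finset.sum_congr rfl fun x' _ =>
    Finset.sum_congr rfl fun y' _ => ?_
  ring

theorem trace_partialTranspose_mul_kronecker (A : Matrix (Fin k × Fin m) (Fin k × Fin m) ℂ)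
    (X : Matrix (Fin k) (Fin k) ℂ) (Y : Matrix (Fin m) (Fin m) ℂ) :
    (partialTranspose A * (Xᵀ ⊗ₖ Y)).trace = (A * (X ⊗ₖ Y)).trace := by
  simp only [trace, diag_apply, partialTranspose, of_apply, mul_apply, Fintype.sum_prod_type,
    kroneckerMap_apply, transpose_apply]
  exact (Finset.sum_congr rfl fun x _ => Finset.sum_comm).trans
    (Finset.sum_comm.trans (Finset.sum_congr rfl fun x _ => Finset.sum_comm))

theorem IsPPT.kronecker_mul_mul {A : Matrix (Fin k × Fin m) (Fin k × Fin m) ℂ} (hA : IsPPT A)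
    {V : Matrix (Fin k) (Fin k) ℂ} {W : Matrix (Fin m) (Fin m) ℂ} (hV : V.IsHermitian)
    (hW : W.IsHermitian) : IsPPT ((V ⊗ₖ W) * A * (V ⊗ₖ W)) := by
  have hVW (V : Matrix (Fin k) (Fin k) ℂ) (hV : V.IsHermitian) : (V ⊗ₖ W)ᴴ = V ⊗ₖ W := by
    rw [conjTranspose_kronecker, hV.eq, hW.eq]
  refine ⟨?_, ?_⟩
  · simpa only [hVW V hV] using hA.1.conjTranspose_mul_mul_same (V ⊗ₖ W)
  · rw [partialTranspose_kronecker_mul_mul]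
    simpa only [hVW _ hV.transpose] using hA.2.conjTranspose_mul_mul_same (Vᵀ ⊗ₖ W)

end PartialTranspose

/-! ### Projections that split a PPT matrix -/

section Splits

variable {k m : ℕ}

theorem sub_kronecker (X X' : Matrix (Fin k) (Fin k) ℂ) (Y : Matrix (Fin m) (Fin m) ℂ) :
    (X - X') ⊗ₖ Y = X ⊗ₖ Y - X' ⊗ₖ Y := by
  ext; simp [kroneckerMap_apply, sub_mul]

theorem kronecker_sub (X : Matrix (Fin k) (Fin k) ℂ) (Y Y' : Matrix (Fin m) (Fin m) ℂ) :
    X ⊗ₖ (Y - Y') = X ⊗ₖ Y - X ⊗ₖ Y' := by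
  ext; simp [kroneckerMap_apply, mul_sub]

theorem sum_kronecker {ι : Type*} (s : Finset ι) (X : ι → Matrix (Fin k) (Fin k) ℂ)
    (Y : Matrix (Fin m) (Fin m) ℂ) : (∑ i ∈ s, X i) ⊗ₖ Y = ∑ i ∈ s, X i ⊗ₖ Y := by
  ext; simp [kroneckerMap_apply, Matrix.sum_apply, Finset.sum_mul]

theorem kronecker_sum {ι : Type*} (s : Finset ι) (X : Matrix (Fin k) (Fin k) ℂ)
    (Y : ι → Matrix (Fin m) (Fin m) ℂ) : X ⊗ₖ (∑ i ∈ s, Y i) = ∑ i ∈ s, X ⊗ₖ Y i := by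
  ext; simp [kroneckerMap_apply, Matrix.sum_apply, Finset.mul_sum]

theorem kronecker_one_mul_one_kronecker (V : Matrix (Fin k) (Fin k) ℂ)
    (W : Matrix (Fin m) (Fin m) ℂ) :
    (V ⊗ₖ (1 : Matrix (Fin m) (Fin m) ℂ)) * ((1 : Matrix (Fin k) (Fin k) ℂ) ⊗ₖ W) = V ⊗ₖ W := by
  rw [← mul_kronecker_mul, Matrix.mul_one, Matrix.one_mul]

theorem one_kronecker_mul_kronecker_one (V : Matrix (Fin k) (Fin k) ℂ)
    (W : Matrix (Fin m) (Fin m) ℂ) :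
    ((1 : Matrix (Fin k) (Fin k) ℂ) ⊗ₖ W) * (V ⊗ₖ (1 : Matrix (Fin m) (Fin m) ℂ)) = V ⊗ₖ W := by
  rw [← mul_kronecker_mul, Matrix.mul_one, Matrix.one_mul]

/-- `A` commutes with `V ⊗ 1` and with `1 ⊗ W`, and `V ⊗ 1` and `1 ⊗ W` have the same product with
`A`. When `V` and `W` are projections this says that `A` is block diagonal with respect to
`V ⊗ W`, `(1 - V) ⊗ (1 - W)`, with no component on `V ⊗ (1 - W)` or `(1 - V) ⊗ W`; unlike the
latter formulation, the three equations are linear in the pair `(V, W)`. -/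
structure Splits (A : Matrix (Fin k × Fin m) (Fin k × Fin m) ℂ) (V : Matrix (Fin k) (Fin k) ℂ)
    (W : Matrix (Fin m) (Fin m) ℂ) : Prop where
  left_comm : (V ⊗ₖ (1 : Matrix (Fin m) (Fin m) ℂ)) * A =
    A * (V ⊗ₖ (1 : Matrix (Fin m) (Fin m) ℂ))
  mul_right : A * ((1 : Matrix (Fin k) (Fin k) ℂ) ⊗ₖ W) =
    A * (V ⊗ₖ (1 : Matrix (Fin m) (Fin m) ℂ))
  right_mul : ((1 : Matrix (Fin k) (Fin k) ℂ) ⊗ₖ W) * A =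
    A * (V ⊗ₖ (1 : Matrix (Fin m) (Fin m) ℂ))

variable {A : Matrix (Fin k × Fin m) (Fin k × Fin m) ℂ}

theorem Splits.one : Splits A 1 1 := by
  constructor <;> simp

theorem Splits.sub {V V' : Matrix (Fin k) (Fin k) ℂ} {W W' : Matrix (Fin m) (Fin m) ℂ}
    (h : Splits A V W) (h' : Splits A V' W') : Splits A (V - V') (W - W') where
  left_comm := by
    rw [sub_kronecker, Matrix.sub_mul, Matrix.mul_sub, h.left_comm, h'.left_comm]
  mul_right := by
    rw [sub_kronecker, kronecker_sub, Matrix.mul_sub, Matrix.mul_sub, h.mul_right, h'.mul_right]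
  right_mul := by
    rw [sub_kronecker, kronecker_sub, Matrix.sub_mul, Matrix.mul_sub, h.right_mul, h'.right_mul]

theorem Splits.sum {s : ℕ} {V : Fin s → Matrix (Fin k) (Fin k) ℂ}
    {W : Fin s → Matrix (Fin m) (Fin m) ℂ} (h : ∀ i, Splits A (V i) (W i)) :
    Splits A (∑ i, V i) (∑ i, W i) where
  left_comm := by
    simp only [sum_kronecker, Finset.sum_mul, Finset.mul_sum, (h _).left_comm]
  mul_right := by
    simp only [sum_kronecker, kronecker_sum, Finset.mul_sum, (h _).mul_right]
  right_mul := by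
    simp only [sum_kronecker, kronecker_sum, Finset.sum_mul, Finset.mul_sum, (h _).right_mul]

/-- A block of a split matrix is cut out by the projection on one factor alone. -/
theorem Splits.compress {V : Matrix (Fin k) (Fin k) ℂ} {W : Matrix (Fin m) (Fin m) ℂ}
    (h : Splits A V W) (hV : V * V = V) :
    (V ⊗ₖ W) * A * (V ⊗ₖ W) = A * (V ⊗ₖ (1 : Matrix (Fin m) (Fin m) ℂ)) := by
  have hv : (V ⊗ₖ (1 : Matrix (Fin m) (Fin m) ℂ)) * (V ⊗ₖ (1 : Matrix (Fin m) (Fin m) ℂ)) =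
      V ⊗ₖ (1 : Matrix (Fin m) (Fin m) ℂ) := by rw [← mul_kronecker_mul, hV, Matrix.mul_one]
  have hr : A * (V ⊗ₖ W) = A * (V ⊗ₖ (1 : Matrix (Fin m) (Fin m) ℂ)) := by
    rw [← one_kronecker_mul_kronecker_one, ← Matrix.mul_assoc, h.mul_right, Matrix.mul_assoc, hv]
  rw [Matrix.mul_assoc, hr, ← kronecker_one_mul_one_kronecker, Matrix.mul_assoc, ← Matrix.mul_assoc
    _ A, h.right_mul, Matrix.mul_assoc, hv, ← Matrix.mul_assoc, h.left_comm, Matrix.mul_assoc, hv]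

theorem Matrix.IsHermitian.posSemidef_of_mul_self {ι : Type*} [Fintype ι] {V : Matrix ι ι ℂ}
    (hV : V.IsHermitian) (h : V * V = V) : V.PosSemidef := by
  have := posSemidef_conjTranspose_mul_self V
  rwa [hV.eq, h] at this

theorem posSemidef_one_sub_projMatrix (U : Submodule ℂ (EuclideanSpace ℂ (Fin k))) :
    (1 - projMatrix U).PosSemidef := by
  refine Matrix.IsHermitian.posSemidef_of_mul_self
    (isHermitian_one.sub (projMatrix_isHermitian U)) ?_
  rw [Matrix.mul_sub, Matrix.sub_mul, Matrix.sub_mul, projMatrix_mul_self]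
  simp

/-- The point where positivity of the partial transpose enters. Positivity of `A` turns the two
trace conditions into `A ((1 - V) ⊗ W) = 0` and `A (V ⊗ (1 - W)) = 0`; positivity of the partial
transpose gives `A^{t₁} ((1 - V)ᵗ ⊗ W) = 0`, and since partial transposition exchanges the outer
factors on the first leg, the remaining off-diagonal block `(V ⊗ W) A ((1 - V) ⊗ (1 - W))`
vanishes too. -/
theorem IsPPT.splits (hA : IsPPT A) {X : Matrix (Fin k) (Fin k) ℂ} {Y : Matrix (Fin m) (Fin m) ℂ}
    (hX : X.PosSemidef) (hY : Y.PosSemidef)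
    (h₁ : (A * ((1 - projMatrix (matrixImage X)) ⊗ₖ Y)).trace = 0)
    (h₂ : (A * (X ⊗ₖ (1 - projMatrix (matrixImage Y)))).trace = 0) :
    Splits A (projMatrix (matrixImage X)) (projMatrix (matrixImage Y)) := by
  obtain ⟨Z, hZ⟩ := exists_projMatrix_image_eq_mul X
  obtain ⟨Z', hZ'⟩ := exists_projMatrix_image_eq_mul Y
  have hV := projMatrix_isHermitian (matrixImage X)
  have hW := projMatrix_isHermitian (matrixImage Y)
  have hV' := posSemidef_one_sub_projMatrix (matrixImage X)
  have hW' := posSemidef_one_sub_projMatrix (matrixImage Y)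
  set V := projMatrix (matrixImage X)
  set W := projMatrix (matrixImage Y)
  have a : A * ((1 - V) ⊗ₖ W) = 0 := by
    rw [hZ', ← Matrix.mul_one (1 - V), mul_kronecker_mul, ← Matrix.mul_assoc,
      hA.1.mul_eq_zero_of_trace (hV'.kronecker hY) h₁, Matrix.zero_mul]
  have b : A * (V ⊗ₖ (1 - W)) = 0 := by
    rw [hZ, ← Matrix.mul_one (1 - W), mul_kronecker_mul, ← Matrix.mul_assoc,
      hA.1.mul_eq_zero_of_trace (hX.kronecker hW') h₂, Matrix.zero_mul]
  have a' : partialTranspose A * ((1 - V)ᵀ ⊗ₖ W) = 0 := by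
    rw [hZ', ← Matrix.mul_one (1 - V)ᵀ, mul_kronecker_mul, ← Matrix.mul_assoc,
      hA.2.mul_eq_zero_of_trace (hV'.transpose.kronecker hY)
        (by rw [trace_partialTranspose_mul_kronecker, h₁]), Matrix.zero_mul]
  have a'' : ((1 - V)ᵀ ⊗ₖ W) * partialTranspose A = 0 := by
    rw [← conjTranspose_eq_zero, conjTranspose_mul, conjTranspose_kronecker, hA.2.isHermitian.eq,
      hV'.transpose.isHermitian.eq, hW.eq, a']
  have c : (V ⊗ₖ W) * A * ((1 - V) ⊗ₖ (1 - W)) = 0 := by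
    have : partialTranspose ((V ⊗ₖ W) * A * ((1 - V) ⊗ₖ (1 - W))) = 0 := by
      rw [partialTranspose_kronecker_mul_mul, a'', Matrix.zero_mul]
    exact congrArg partialTranspose this
  have hv : (V ⊗ₖ (1 : Matrix (Fin m) (Fin m) ℂ))ᴴ = V ⊗ₖ (1 : Matrix (Fin m) (Fin m) ℂ) := by
    rw [conjTranspose_kronecker, hV.eq, conjTranspose_one]
  have hw : ((1 : Matrix (Fin k) (Fin k) ℂ) ⊗ₖ W)ᴴ = (1 : Matrix (Fin k) (Fin k) ℂ) ⊗ₖ W := by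
    rw [conjTranspose_kronecker, hW.eq, conjTranspose_one]
  have hvw := kronecker_one_mul_one_kronecker V W
  have hwv := one_kronecker_mul_kronecker_one V W
  have hP : (V ⊗ₖ W)ᴴ = V ⊗ₖ W := by rw [conjTranspose_kronecker, hV.eq, hW.eq]
  rw [sub_kronecker, Matrix.mul_sub, sub_eq_zero] at a
  rw [kronecker_sub, Matrix.mul_sub, sub_eq_zero] at b
  rw [kronecker_sub, sub_kronecker, sub_kronecker, one_kronecker_one] at c
  -- With `P = V ⊗ W`: `P A = P A P`, by `c` and the vanishing of the mixed components.
  have hPA : (V ⊗ₖ W) * A = (V ⊗ₖ W) * (A * (V ⊗ₖ W)) := by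
    simp only [Matrix.mul_sub, Matrix.mul_assoc, a, b, Matrix.mul_one] at c
    rw [sub_self, sub_zero] at c
    exact sub_eq_zero.mp c
  have hAP : A * (V ⊗ₖ W) = (V ⊗ₖ W) * (A * (V ⊗ₖ W)) := by
    have := congrArg conjTranspose hPA
    simpa only [conjTranspose_mul, hP, hA.1.isHermitian.eq, Matrix.mul_assoc] using this
  have a2 : ((1 : Matrix (Fin k) (Fin k) ℂ) ⊗ₖ W) * A = (V ⊗ₖ W) * A := by
    have := congrArg conjTranspose a
    simpa only [conjTranspose_mul, hP, hw, hA.1.isHermitian.eq] using this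
  have b2 : (V ⊗ₖ (1 : Matrix (Fin m) (Fin m) ℂ)) * A = (V ⊗ₖ W) * A := by
    have := congrArg conjTranspose b
    simpa only [conjTranspose_mul, hP, hv, hA.1.isHermitian.eq] using this
  exact ⟨by rw [b2, b, hPA, ← hAP], by rw [a, b], by rw [a2, b, hPA, ← hAP]⟩

end Splits

/-! ### Real combinations of a Hermitian orthonormal family -/

section RealComb

variable {k n : ℕ}

/-- The real linear combination `∑ xᵢ γᵢ`. The coefficients live in a Euclidean space, so that
`realComb γ` is an isometry when `γ` is Hermitian and orthonormal. -/
noncomputable def realComb (γ : Fin n → Matrix (Fin k) (Fin k) ℂ) :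
    EuclideanSpace ℝ (Fin n) →ₗ[ℝ] Matrix (Fin k) (Fin k) ℂ where
  toFun x := ∑ i, (x i : ℂ) • γ i
  map_add' x y := by simp [add_smul, Finset.sum_add_distrib]
  map_smul' c x := by
    simp only [Finset.smul_sum, PiLp.smul_apply, smul_eq_mul, Complex.ofReal_mul, mul_smul,
      Complex.coe_smul, RingHom.id_apply]

theorem realComb_apply (γ : Fin n → Matrix (Fin k) (Fin k) ℂ) (x : EuclideanSpace ℝ (Fin n)) :
    realComb γ x = ∑ i, (x i : ℂ) • γ i := rfl

variable {γ : Fin n → Matrix (Fin k) (Fin k) ℂ}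

theorem realComb_isHermitian (hγ : ∀ i, (γ i).IsHermitian) (x : EuclideanSpace ℝ (Fin n)) :
    (realComb γ x).IsHermitian := by
  rw [IsHermitian, realComb_apply, conjTranspose_sum]
  refine Finset.sum_congr rfl fun i _ => ?_
  rw [conjTranspose_smul, (hγ i).eq]
  simp

theorem trace_realComb_mul (γ : Fin n → Matrix (Fin k) (Fin k) ℂ) (x : EuclideanSpace ℝ (Fin n))
    (X : Matrix (Fin k) (Fin k) ℂ) :
    (realComb γ x * X).trace = ∑ i, (x i : ℂ) * (γ i * X).trace := by
  simp [realComb_apply, Finset.sum_mul, trace_sum]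

theorem TraceOrthonormal.trace_mul (h : TraceOrthonormal γ) (hγ : ∀ i, (γ i).IsHermitian)
    (i j : Fin n) : (γ i * γ j).trace = if i = j then 1 else 0 := by
  rw [← h i j, (hγ j).eq]

theorem trace_realComb_mul_realComb (h : TraceOrthonormal γ) (hγ : ∀ i, (γ i).IsHermitian)
    (x y : EuclideanSpace ℝ (Fin n)) :
    (realComb γ x * realComb γ y).trace = (inner ℝ x y : ℝ) := by
  rw [trace_realComb_mul, PiLp.inner_apply, Complex.ofReal_sum]
  refine Finset.sum_congr rfl fun i _ => ?_
  rw [trace_mul_comm, trace_realComb_mul, Finset.sum_eq_single i]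
  · simp [h.trace_mul hγ, mul_comm]
  · intro j _ hj
    simp [h.trace_mul hγ, hj]
  · simp

theorem realComb_injective (h : TraceOrthonormal γ) (hγ : ∀ i, (γ i).IsHermitian) :
    Function.Injective (realComb γ) := by
  rw [injective_iff_map_eq_zero]
  intro x hx
  have := trace_realComb_mul_realComb h hγ x x
  rw [hx, Matrix.mul_zero, trace_zero] at this
  exact inner_self_eq_zero.mp (Complex.ofReal_eq_zero.mp this.symm)

/-- Bessel's identity for the Fourier coefficients of a Hermitian matrix. -/
theorem re_trace_sub_realComb_sq (h : TraceOrthonormal γ) (hγ : ∀ i, (γ i).IsHermitian)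
    (X : Matrix (Fin k) (Fin k) ℂ) (x : EuclideanSpace ℝ (Fin n))
    (hx : ∀ i, x i = (γ i * X).trace.re) :
    ((X - realComb γ x) * (X - realComb γ x)).trace.re = (X * X).trace.re - ∑ i, x i ^ 2 := by
  have h1 : (realComb γ x * X).trace.re = ∑ i, x i ^ 2 := by
    rw [trace_realComb_mul, Complex.re_sum]
    refine Finset.sum_congr rfl fun i _ => ?_
    rw [Complex.re_ofReal_mul, ← hx, sq]
  have h2 : (realComb γ x * realComb γ x).trace.re = ∑ i, x i ^ 2 := by
    rw [trace_realComb_mul_realComb h hγ, Complex.ofReal_re, PiLp.inner_apply]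
    simp [sq]
  rw [Matrix.mul_sub, Matrix.sub_mul, Matrix.sub_mul, trace_sub, trace_sub, trace_sub,
    trace_mul_comm X (realComb γ x), Complex.sub_re, Complex.sub_re, Complex.sub_re, h1, h2]
  ring

end RealComb

/-! ### The top part of a Hermitian Schmidt decomposition -/

section Top

variable {k m s : ℕ}

/-- The terms `γᵢ ⊗ δᵢ` of a Hermitian Schmidt decomposition of `A` that belong to the largest
coefficient `L`, described through the bilinear form `(X, Y) ↦ tr (A (X ⊗ Y))`: this form sends
`(γᵢ, ·)` to `L δᵢ` and `(·, δᵢ)` to `L γᵢ`, and a Hermitian pair attains the bound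
`2 tr (A (X ⊗ Y)) ≤ L (‖X‖² + ‖Y‖²)` only if it is `(∑ xᵢ γᵢ, ∑ xᵢ δᵢ)` for some real `x`. -/
structure IsTopSchmidt (A : Matrix (Fin k × Fin m) (Fin k × Fin m) ℂ) (L : ℝ)
    (γ : Fin s → Matrix (Fin k) (Fin k) ℂ) (δ : Fin s → Matrix (Fin m) (Fin m) ℂ) : Prop where
  pos : 0 < L
  left_hermitian : ∀ i, (γ i).IsHermitian
  right_hermitian : ∀ i, (δ i).IsHermitian
  left_orthonormal : TraceOrthonormal γ
  right_orthonormal : TraceOrthonormal δ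
  trace_left : ∀ i Y, (A * (γ i ⊗ₖ Y)).trace = (L : ℂ) * (δ i * Y).trace
  trace_right : ∀ i X, (A * (X ⊗ₖ δ i)).trace = (L : ℂ) * (γ i * X).trace
  exists_of_le : ∀ (X : Matrix (Fin k) (Fin k) ℂ) (Y : Matrix (Fin m) (Fin m) ℂ),
    X.IsHermitian → Y.IsHermitian →
    L * ((X * X).trace.re + (Y * Y).trace.re) ≤ 2 * (A * (X ⊗ₖ Y)).trace.re →
    ∃ x, X = realComb γ x ∧ Y = realComb δ x

theorem IsHermitianSchmidt.trace_mul_kronecker {n : ℕ}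
    {A : Matrix (Fin k × Fin m) (Fin k × Fin m) ℂ} {lam : Fin n → ℝ}
    {γ : Fin n → Matrix (Fin k) (Fin k) ℂ} {δ : Fin n → Matrix (Fin m) (Fin m) ℂ}
    (h : IsHermitianSchmidt A lam γ δ) (X : Matrix (Fin k) (Fin k) ℂ)
    (Y : Matrix (Fin m) (Fin m) ℂ) :
    (A * (X ⊗ₖ Y)).trace = ∑ i, (lam i : ℂ) * ((γ i * X).trace * (δ i * Y).trace) := by
  rw [h.eq_sum, Finset.sum_mul, trace_sum]
  refine Finset.sum_congr rfl fun i _ => ?_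
  rw [smul_mul_assoc, trace_smul, ← mul_kronecker_mul, trace_kronecker, smul_eq_mul]

theorem IsHermitianSchmidt.isTopSchmidt {n : ℕ}
    {A : Matrix (Fin k × Fin m) (Fin k × Fin m) ℂ} {lam : Fin n → ℝ}
    {γ : Fin n → Matrix (Fin k) (Fin k) ℂ} {δ : Fin n → Matrix (Fin m) (Fin m) ℂ}
    (h : IsHermitianSchmidt A lam γ δ) (hsn : s ≤ n) {L : ℝ} (hL : 0 < L)
    (heq : ∀ i : Fin n, (i : ℕ) < s → lam i = L) (hlt : ∀ i : Fin n, s ≤ (i : ℕ) → lam i < L) :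
    IsTopSchmidt A L (γ ∘ Fin.castLE hsn) (δ ∘ Fin.castLE hsn) where
  pos := hL
  left_hermitian i := h.left_hermitian _
  right_hermitian i := h.right_hermitian _
  left_orthonormal i j := by
    simpa [Fin.ext_iff] using h.left_orthonormal (Fin.castLE hsn i) (Fin.castLE hsn j)
  right_orthonormal i j := by
    simpa [Fin.ext_iff] using h.right_orthonormal (Fin.castLE hsn i) (Fin.castLE hsn j)
  trace_left i Y := by
    rw [h.trace_mul_kronecker, Finset.sum_eq_single (Fin.castLE hsn i), Function.comp_apply,
      Function.comp_apply, h.left_orthonormal.trace_mul h.left_hermitian, heq _ (by simp)]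
    · simp
    · intro j _ hj
      simp [h.left_orthonormal.trace_mul h.left_hermitian, hj]
    · simp
  trace_right i X := by
    rw [h.trace_mul_kronecker, Finset.sum_eq_single (Fin.castLE hsn i), Function.comp_apply,
      Function.comp_apply, h.right_orthonormal.trace_mul h.right_hermitian, heq _ (by simp)]
    · simp
    · intro j _ hj
      simp [h.right_orthonormal.trace_mul h.right_hermitian, hj]
    · simp
  exists_of_le X Y hX hY hle := by
    set x : EuclideanSpace ℝ (Fin n) := WithLp.toLp 2 fun i => (γ i * X).trace.re
    set y : EuclideanSpace ℝ (Fin n) := WithLp.toLp 2 fun i => (δ i * Y).trace.re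
    have hx (i) : x i = (γ i * X).trace.re := rfl
    have hy (i) : y i = (δ i * Y).trace.re := rfl
    have hXs := re_trace_sub_realComb_sq h.left_orthonormal h.left_hermitian X x hx
    have hYs := re_trace_sub_realComb_sq h.right_orthonormal h.right_hermitian Y y hy
    have hX' := hX.sub (realComb_isHermitian h.left_hermitian x)
    have hY' := hY.sub (realComb_isHermitian h.right_hermitian y)
    have htr : (A * (X ⊗ₖ Y)).trace.re = ∑ i, lam i * (x i * y i) := by
      rw [h.trace_mul_kronecker, Complex.re_sum]
      refine Finset.sum_congr rfl fun i _ => ?_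
      rw [← (h.left_hermitian i).ofReal_re_trace_mul hX,
        ← (h.right_hermitian i).ofReal_re_trace_mul hY, ← hx, ← hy]
      norm_cast
    -- The deficit in the bound, written as a sum of nonnegative terms.
    have hid : L * ((X * X).trace.re + (Y * Y).trace.re) - 2 * (A * (X ⊗ₖ Y)).trace.re =
        L * ((X - realComb γ x) * (X - realComb γ x)).trace.re +
        L * ((Y - realComb δ y) * (Y - realComb δ y)).trace.re +
        ∑ i, (lam i * (x i - y i) ^ 2 + (L - lam i) * (x i ^ 2 + y i ^ 2)) := by
      have : ∑ i, (lam i * (x i - y i) ^ 2 + (L - lam i) * (x i ^ 2 + y i ^ 2)) =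
          L * ∑ i, x i ^ 2 + L * ∑ i, y i ^ 2 - 2 * ∑ i, lam i * (x i * y i) := by
        simp only [Finset.mul_sum, ← Finset.sum_add_distrib, ← Finset.sum_sub_distrib]
        exact Finset.sum_congr rfl fun i _ => by ring
      rw [this, hXs, hYs, htr]
      ring
    have hlam (i : Fin n) : lam i ≤ L := by
      rcases lt_or_ge (i : ℕ) s with hi | hi
      · exact (heq i hi).le
      · exact (hlt i hi).le
    have n1 := mul_nonneg hL.le hX'.re_trace_mul_self_nonneg
    have n2 := mul_nonneg hL.le hY'.re_trace_mul_self_nonneg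
    have n3 (i : Fin n) : 0 ≤ lam i * (x i - y i) ^ 2 :=
      mul_nonneg (h.lam_pos i).le (sq_nonneg _)
    have n4 (i : Fin n) : 0 ≤ (L - lam i) * (x i ^ 2 + y i ^ 2) :=
      mul_nonneg (sub_nonneg.mpr (hlam i)) (by positivity)
    have n5 := Finset.sum_nonneg fun i (_ : i ∈ Finset.univ) => add_nonneg (n3 i) (n4 i)
    have hXeq : X = realComb γ x := sub_eq_zero.mp <| hX'.eq_zero_of_re_trace_mul_self <|
      (mul_eq_zero.mp (by linarith)).resolve_left hL.ne'
    have hYeq : Y = realComb δ y := sub_eq_zero.mp <| hY'.eq_zero_of_re_trace_mul_self <|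
      (mul_eq_zero.mp (by linarith)).resolve_left hL.ne'
    have hz := (Finset.sum_eq_zero_iff_of_nonneg
      fun i (_ : i ∈ Finset.univ) => add_nonneg (n3 i) (n4 i)).mp (by linarith)
    have hxy (i : Fin n) : x i = y i := by
      have := (mul_eq_zero.mp (by linarith [hz i (Finset.mem_univ i), n3 i, n4 i] :
        lam i * (x i - y i) ^ 2 = 0)).resolve_left (h.lam_pos i).ne'
      exact sub_eq_zero.mp (pow_eq_zero_iff two_ne_zero |>.mp this)
    have hx0 (i : Fin n) (hi : s ≤ (i : ℕ)) : x i = 0 := by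
      have := (mul_eq_zero.mp (by linarith [hz i (Finset.mem_univ i), n3 i, n4 i] :
        (L - lam i) * (x i ^ 2 + y i ^ 2) = 0)).resolve_left (sub_pos.mpr (hlt i hi)).ne'
      nlinarith [sq_nonneg (x i), sq_nonneg (y i)]
    have hrange (i : Fin n) (hi : i ∉ Set.range (Fin.castLE hsn)) : s ≤ (i : ℕ) := by
      by_contra! hlt'
      exact hi ⟨⟨i, hlt'⟩, rfl⟩
    refine ⟨WithLp.toLp 2 fun i => x (Fin.castLE hsn i), ?_, ?_⟩
    · rw [hXeq, realComb_apply, realComb_apply]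
      refine (Fintype.sum_of_injective _ (Fin.castLE_injective hsn) _ _ (fun i hi => ?_)
        fun i => rfl).symm
      rw [hx0 i (hrange i hi), Complex.ofReal_zero, zero_smul]
    · rw [hYeq, realComb_apply, realComb_apply]
      refine (Fintype.sum_of_injective _ (Fin.castLE_injective hsn) _ _ (fun i hi => ?_)
        fun i => by simp [← hxy]).symm
      rw [← hxy, hx0 i (hrange i hi), Complex.ofReal_zero, zero_smul]

end Top

/-! ### Positive elements of the top part -/

section Cone

variable {k m s : ℕ} {A : Matrix (Fin k × Fin m) (Fin k × Fin m) ℂ} {L : ℝ}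
  {γ : Fin s → Matrix (Fin k) (Fin k) ℂ} {δ : Fin s → Matrix (Fin m) (Fin m) ℂ}

theorem IsTopSchmidt.trace_realComb_left (h : IsTopSchmidt A L γ δ)
    (x : EuclideanSpace ℝ (Fin s)) (Y : Matrix (Fin m) (Fin m) ℂ) :
    (A * (realComb γ x ⊗ₖ Y)).trace = (L : ℂ) * (realComb δ x * Y).trace := by
  rw [trace_realComb_mul, realComb_apply, sum_kronecker, Finset.mul_sum, trace_sum, Finset.mul_sum]
  refine Finset.sum_congr rfl fun i _ => ?_
  rw [smul_kronecker, mul_smul_comm, trace_smul, h.trace_left, smul_eq_mul]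
  ring

theorem IsTopSchmidt.trace_realComb_right (h : IsTopSchmidt A L γ δ)
    (x : EuclideanSpace ℝ (Fin s)) (X : Matrix (Fin k) (Fin k) ℂ) :
    (A * (X ⊗ₖ realComb δ x)).trace = (L : ℂ) * (realComb γ x * X).trace := by
  rw [trace_realComb_mul, realComb_apply, kronecker_sum, Finset.mul_sum, trace_sum, Finset.mul_sum]
  refine Finset.sum_congr rfl fun i _ => ?_
  rw [kronecker_smul, mul_smul_comm, trace_smul, h.trace_right, smul_eq_mul]
  ring

/-- The coefficient vector `x` gives positive semidefinite combinations on both tensor factors. -/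
def IsPosPair (γ : Fin s → Matrix (Fin k) (Fin k) ℂ) (δ : Fin s → Matrix (Fin m) (Fin m) ℂ)
    (x : EuclideanSpace ℝ (Fin s)) : Prop :=
  (realComb γ x).PosSemidef ∧ (realComb δ x).PosSemidef

theorem re_trace_add_mul_add {ι : Type*} [Fintype ι] {P N : Matrix ι ι ℂ}
    (hP : P.IsHermitian) (hN : N.IsHermitian) (h : P * N = 0) :
    ((P + N) * (P + N)).trace.re = ((P - N) * (P - N)).trace.re := by
  have h' : N * P = 0 := by
    rw [← conjTranspose_eq_zero, conjTranspose_mul, hP.eq, hN.eq, h]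
  simp [Matrix.mul_add, Matrix.add_mul, Matrix.mul_sub, Matrix.sub_mul, h, h']

/-- The top part is closed under Jordan decomposition: replacing `X` and `Y` by their absolute
values keeps the norms and, `A` being positive semidefinite, does not decrease
`tr (A (X ⊗ Y))`, so the extremal pairs are stable under it. -/
theorem IsTopSchmidt.exists_sub_isPosPair (h : IsTopSchmidt A L γ δ) (hA : A.PosSemidef)
    (x : EuclideanSpace ℝ (Fin s)) :
    ∃ p q, IsPosPair γ δ p ∧ IsPosPair γ δ q ∧ x = p - q ∧
      realComb γ p * realComb γ q = 0 ∧ realComb δ p * realComb δ q = 0 := by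
  obtain ⟨P, N, hP, hN, hX, hPN⟩ :=
    (realComb_isHermitian h.left_hermitian x).exists_sub_posSemidef
  obtain ⟨P', N', hP', hN', hY, hPN'⟩ :=
    (realComb_isHermitian h.right_hermitian x).exists_sub_posSemidef
  have t1 := (Complex.le_def.mp (hA.trace_mul_nonneg (hP.kronecker hN'))).1
  have t2 := (Complex.le_def.mp (hA.trace_mul_nonneg (hN.kronecker hP'))).1
  have e1 : (realComb γ x * realComb γ x).trace.re = inner ℝ x x := by
    rw [trace_realComb_mul_realComb h.left_orthonormal h.left_hermitian, Complex.ofReal_re]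
  have e2 : (realComb δ x * realComb δ x).trace.re = inner ℝ x x := by
    rw [trace_realComb_mul_realComb h.right_orthonormal h.right_hermitian, Complex.ofReal_re]
  have e3 : (A * (realComb γ x ⊗ₖ realComb δ x)).trace.re = L * inner ℝ x x := by
    rw [h.trace_realComb_left, Complex.re_ofReal_mul, e2]
  have e4 : (A * ((P + N) ⊗ₖ (P' + N'))).trace.re = (A * ((P - N) ⊗ₖ (P' - N'))).trace.re +
      2 * (A * (P ⊗ₖ N')).trace.re + 2 * (A * (N ⊗ₖ P')).trace.re := by
    simp only [add_kronecker, kronecker_add, sub_kronecker, kronecker_sub, Matrix.mul_add,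
      Matrix.mul_sub, trace_add, trace_sub, Complex.add_re, Complex.sub_re]
    ring
  obtain ⟨z, hz, hz'⟩ := h.exists_of_le (P + N) (P' + N') (hP.add hN).isHermitian
    (hP'.add hN').isHermitian (by
      rw [re_trace_add_mul_add hP.isHermitian hN.isHermitian hPN,
        re_trace_add_mul_add hP'.isHermitian hN'.isHermitian hPN', e4, ← hX, ← hY, e1, e2, e3]
      simp only [Complex.zero_re] at t1 t2
      linarith)
  have half (k : ℕ) (P N : Matrix (Fin k) (Fin k) ℂ) :
      (2⁻¹ : ℝ) • (P + N + (P - N)) = P ∧ (2⁻¹ : ℝ) • (P + N - (P - N)) = N := by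
    constructor
    · rw [add_add_sub_cancel, ← two_smul ℝ P, smul_smul]; norm_num
    · rw [add_sub_sub_cancel, ← two_smul ℝ N, smul_smul]; norm_num
  have p1 : realComb γ ((2⁻¹ : ℝ) • (z + x)) = P := by
    rw [map_smul, map_add, ← hz, hX]; exact (half k P N).1
  have p2 : realComb δ ((2⁻¹ : ℝ) • (z + x)) = P' := by
    rw [map_smul, map_add, ← hz', hY]; exact (half m P' N').1
  have q1 : realComb γ ((2⁻¹ : ℝ) • (z - x)) = N := by
    rw [map_smul, map_sub, ← hz, hX]; exact (half k P N).2
  have q2 : realComb δ ((2⁻¹ : ℝ) • (z - x)) = N' := by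
    rw [map_smul, map_sub, ← hz', hY]; exact (half m P' N').2
  refine ⟨(2⁻¹ : ℝ) • (z + x), (2⁻¹ : ℝ) • (z - x), ⟨p1 ▸ hP, p2 ▸ hP'⟩, ⟨q1 ▸ hN, q2 ▸ hN'⟩, ?_,
    by rw [p1, q1, hPN], by rw [p2, q2, hPN']⟩
  apply realComb_injective h.left_orthonormal h.left_hermitian
  rw [map_sub, p1, q1, hX]

theorem IsTopSchmidt.mul_eq_zero_of_inner (h : IsTopSchmidt A L γ δ)
    {x y : EuclideanSpace ℝ (Fin s)} (hx : IsPosPair γ δ x) (hy : IsPosPair γ δ y)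
    (hxy : inner ℝ x y = 0) :
    realComb γ x * realComb γ y = 0 ∧ realComb δ x * realComb δ y = 0 :=
  ⟨hx.1.mul_eq_zero_of_trace hy.1 (by
    rw [trace_realComb_mul_realComb h.left_orthonormal h.left_hermitian, hxy, Complex.ofReal_zero]),
  hx.2.mul_eq_zero_of_trace hy.2 (by
    rw [trace_realComb_mul_realComb h.right_orthonormal h.right_hermitian, hxy,
      Complex.ofReal_zero])⟩

theorem IsTopSchmidt.inner_eq_zero_of_mul (h : IsTopSchmidt A L γ δ)
    {x y : EuclideanSpace ℝ (Fin s)} (hxy : realComb γ x * realComb γ y = 0) :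
    inner ℝ x y = 0 := by
  have := trace_realComb_mul_realComb h.left_orthonormal h.left_hermitian x y
  rw [hxy, trace_zero] at this
  exact Complex.ofReal_eq_zero.mp this.symm

/-- If `p - q` is annihilated by `y` and `p ⟂ q`, then `p` and `q` are separately orthogonal
to `y`. -/
theorem IsTopSchmidt.inner_eq_zero_of_sub_mul (h : IsTopSchmidt A L γ δ)
    {p q y : EuclideanSpace ℝ (Fin s)} (hpq : realComb γ p * realComb γ q = 0)
    (hy : realComb γ (p - q) * realComb γ y = 0) : inner ℝ p y = 0 ∧ inner ℝ q y = 0 := by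
  have hp := realComb_isHermitian h.left_hermitian p
  have hq := realComb_isHermitian h.left_hermitian q
  have hqp : realComb γ q * realComb γ p = 0 := by
    rw [← conjTranspose_eq_zero, conjTranspose_mul, hp.eq, hq.eq, hpq]
  have aux (x : EuclideanSpace ℝ (Fin s)) (hx : realComb γ x * realComb γ x * realComb γ y = 0) :
      inner ℝ x y = 0 := by
    apply h.inner_eq_zero_of_mul
    rw [← conjTranspose_mul_self_eq_zero, conjTranspose_mul,
      (realComb_isHermitian h.left_hermitian x).eq, Matrix.mul_assoc,
      ← Matrix.mul_assoc (realComb γ x), hx, Matrix.mul_zero]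
  rw [map_sub] at hy
  constructor
  · apply aux
    have := congrArg (realComb γ p * ·) hy
    simpa [← Matrix.mul_assoc, Matrix.mul_sub, hpq] using this
  · apply aux
    have := congrArg (realComb γ q * ·) hy
    simpa [← Matrix.mul_assoc, Matrix.mul_sub, hqp] using this

theorem IsTopSchmidt.splits (h : IsTopSchmidt A L γ δ) (hA : IsPPT A)
    {x : EuclideanSpace ℝ (Fin s)} (hx : IsPosPair γ δ x) :
    Splits A (projMatrix (matrixImage (realComb γ x)))
      (projMatrix (matrixImage (realComb δ x))) := by
  refine hA.splits hx.1 hx.2 ?_ ?_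
  · rw [h.trace_realComb_right, trace_mul_comm, Matrix.sub_mul, projMatrix_image_mul]
    simp
  · rw [h.trace_realComb_left, trace_mul_comm, Matrix.sub_mul, projMatrix_image_mul]
    simp

/-- A splitting pair of projections commutes with the top part and compresses it into itself. -/
theorem IsTopSchmidt.exists_mul_eq_realComb (h : IsTopSchmidt A L γ δ)
    {V : Matrix (Fin k) (Fin k) ℂ} {W : Matrix (Fin m) (Fin m) ℂ} (hS : Splits A V W)
    (hV : V.IsHermitian) (hW : W.IsHermitian) (hVV : V * V = V) (hWW : W * W = W)
    (z : EuclideanSpace ℝ (Fin s)) :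
    V * realComb γ z = realComb γ z * V ∧ ∃ w, realComb γ z * V = realComb γ w := by
  have hL : (L : ℂ) ≠ 0 := Complex.ofReal_ne_zero.mpr h.pos.ne'
  have hX := realComb_isHermitian h.left_hermitian z
  have hY := realComb_isHermitian h.right_hermitian z
  -- Multiplying `X` by `V`, or `Y` by `W`, on either side has the same effect on `tr (A (X ⊗ Y))`.
  have r1 (X : Matrix (Fin k) (Fin k) ℂ) (Y : Matrix (Fin m) (Fin m) ℂ) :
      (A * ((X * V) ⊗ₖ Y)).trace = (A * ((V * X) ⊗ₖ Y)).trace := by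
    have e : (X * V) ⊗ₖ Y = (X ⊗ₖ Y) * (V ⊗ₖ (1 : Matrix (Fin m) (Fin m) ℂ)) := by
      rw [← mul_kronecker_mul, Matrix.mul_one]
    have e' : (V * X) ⊗ₖ Y = (V ⊗ₖ (1 : Matrix (Fin m) (Fin m) ℂ)) * (X ⊗ₖ Y) := by
      rw [← mul_kronecker_mul, Matrix.one_mul]
    rw [e, e', ← Matrix.mul_assoc, trace_mul_comm, ← Matrix.mul_assoc, ← Matrix.mul_assoc,
      hS.left_comm]
  have r2 (X : Matrix (Fin k) (Fin k) ℂ) (Y : Matrix (Fin m) (Fin m) ℂ) :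
      (A * (X ⊗ₖ (W * Y))).trace = (A * ((V * X) ⊗ₖ Y)).trace := by
    have e : X ⊗ₖ (W * Y) = ((1 : Matrix (Fin k) (Fin k) ℂ) ⊗ₖ W) * (X ⊗ₖ Y) := by
      rw [← mul_kronecker_mul, Matrix.one_mul]
    have e' : (V * X) ⊗ₖ Y = (V ⊗ₖ (1 : Matrix (Fin m) (Fin m) ℂ)) * (X ⊗ₖ Y) := by
      rw [← mul_kronecker_mul, Matrix.one_mul]
    rw [e, e', ← Matrix.mul_assoc, ← Matrix.mul_assoc, hS.mul_right]
  have r3 (X : Matrix (Fin k) (Fin k) ℂ) (Y : Matrix (Fin m) (Fin m) ℂ) :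
      (A * (X ⊗ₖ (Y * W))).trace = (A * ((V * X) ⊗ₖ Y)).trace := by
    have e : X ⊗ₖ (Y * W) = (X ⊗ₖ Y) * ((1 : Matrix (Fin k) (Fin k) ℂ) ⊗ₖ W) := by
      rw [← mul_kronecker_mul, Matrix.mul_one]
    have e' : (V * X) ⊗ₖ Y = (V ⊗ₖ (1 : Matrix (Fin m) (Fin m) ℂ)) * (X ⊗ₖ Y) := by
      rw [← mul_kronecker_mul, Matrix.one_mul]
    rw [e, e', ← Matrix.mul_assoc, trace_mul_comm, ← Matrix.mul_assoc, ← Matrix.mul_assoc,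
      hS.right_mul]
  have c1 : V * realComb γ z = realComb γ z * V := by
    rw [ext_iff_trace_mul_right]
    intro X
    apply mul_left_cancel₀ hL
    rw [Matrix.mul_assoc, trace_mul_comm V, Matrix.mul_assoc, Matrix.mul_assoc,
      ← h.trace_realComb_right, ← h.trace_realComb_right, r1]
  have c2 : W * realComb δ z = realComb δ z * W := by
    rw [ext_iff_trace_mul_right]
    intro Y
    apply mul_left_cancel₀ hL
    rw [Matrix.mul_assoc, trace_mul_comm W, Matrix.mul_assoc, Matrix.mul_assoc,
      ← h.trace_realComb_left, ← h.trace_realComb_left, r2, r3]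
  have herm {ι : Type} [Fintype ι] {X V : Matrix ι ι ℂ} (hX : X.IsHermitian)
      (hV : V.IsHermitian) (hc : V * X = X * V) : (X * V).IsHermitian := by
    rw [IsHermitian, conjTranspose_mul, hX.eq, hV.eq, hc]
  -- With `X = γ(z)`, `Y = δ(z)`: both compressions have squared norm `tr (A (X V ⊗ Y W)) / L`.
  have s1 : (A * ((realComb γ z * V) ⊗ₖ (realComb δ z * W))).trace =
      L * ((realComb γ z * V) * (realComb γ z * V)).trace := by
    rw [r3, ← Matrix.mul_assoc, c1, Matrix.mul_assoc, hVV, h.trace_realComb_right,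
      Matrix.mul_assoc, ← Matrix.mul_assoc V, c1, Matrix.mul_assoc, hVV]
  have s2 : (A * ((realComb γ z * V) ⊗ₖ (realComb δ z * W))).trace =
      L * ((realComb δ z * W) * (realComb δ z * W)).trace := by
    rw [r1, ← r2, ← Matrix.mul_assoc, c2, Matrix.mul_assoc, hWW, h.trace_realComb_left,
      Matrix.mul_assoc, ← Matrix.mul_assoc W, c2, Matrix.mul_assoc, hWW]
  obtain ⟨w, hw, -⟩ := h.exists_of_le _ _ (herm hX hV c1) (herm hY hW c2) (by
    have s1' := congrArg Complex.re s1
    have s2' := congrArg Complex.re s2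
    rw [Complex.re_ofReal_mul] at s1' s2'
    linarith)
  exact ⟨c1, w, hw⟩

end Cone

/-! ### An orthonormal basis of positive elements -/

section Basis

variable {k m s : ℕ} {A : Matrix (Fin k × Fin m) (Fin k × Fin m) ℂ} {L : ℝ}
  {γ : Fin s → Matrix (Fin k) (Fin k) ℂ} {δ : Fin s → Matrix (Fin m) (Fin m) ℂ}

/-- A finite set of nonzero, pairwise orthogonal coefficient vectors with positive semidefinite
combinations on both factors. -/
structure IsPosOrthogonal (γ : Fin s → Matrix (Fin k) (Fin k) ℂ)
    (δ : Fin s → Matrix (Fin m) (Fin m) ℂ) (S : Finset (EuclideanSpace ℝ (Fin s))) : Prop where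
  ne_zero : ∀ x ∈ S, x ≠ 0
  isPosPair : ∀ x ∈ S, IsPosPair γ δ x
  orthogonal : ∀ x ∈ S, ∀ y ∈ S, x ≠ y → inner ℝ x y = 0

theorem IsPosOrthogonal.insert [DecidableEq (EuclideanSpace ℝ (Fin s))]
    {S : Finset (EuclideanSpace ℝ (Fin s))} (hS : IsPosOrthogonal γ δ S)
    {p : EuclideanSpace ℝ (Fin s)} (hp : IsPosPair γ δ p) (hp0 : p ≠ 0)
    (h : ∀ x ∈ S, inner ℝ p x = 0) :
    IsPosOrthogonal γ δ (insert p S) ∧ (insert p S).card = S.card + 1 := by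
  have hpS : p ∉ S := fun hpS => hp0 (inner_self_eq_zero.mp (h p hpS))
  refine ⟨⟨?_, ?_, ?_⟩, Finset.card_insert_of_notMem hpS⟩
  · simpa [hp0] using hS.ne_zero
  · simpa [hp] using hS.isPosPair
  · intro x hx y hy hxy
    rcases Finset.mem_insert.mp hx with rfl | hx' <;>
      rcases Finset.mem_insert.mp hy with rfl | hy'
    · exact absurd rfl hxy
    · exact h y hy'
    · rw [real_inner_comm]; exact h x hx'
    · exact hS.orthogonal x hx' y hy' hxy

theorem IsPosOrthogonal.erase [DecidableEq (EuclideanSpace ℝ (Fin s))]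
    {S : Finset (EuclideanSpace ℝ (Fin s))} (hS : IsPosOrthogonal γ δ S)
    (x : EuclideanSpace ℝ (Fin s)) : IsPosOrthogonal γ δ (S.erase x) where
  ne_zero y hy := hS.ne_zero y (Finset.mem_of_mem_erase hy)
  isPosPair y hy := hS.isPosPair y (Finset.mem_of_mem_erase hy)
  orthogonal y hy z hz :=
    hS.orthogonal y (Finset.mem_of_mem_erase hy) z (Finset.mem_of_mem_erase hz)

/-- A positive orthogonal set that does not span can be enlarged. Take `z ≠ 0` orthogonal to it.
If the compression of `z` to the support of some member `x` is nonzero, its positive and negative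
parts are both nonzero, because it is orthogonal to `x`, and they replace `x`. Otherwise the
positive and negative parts of `z` are orthogonal to the whole set, and a nonzero one is added. -/
theorem IsTopSchmidt.exists_isPosOrthogonal_succ (h : IsTopSchmidt A L γ δ) (hA : IsPPT A)
    {S : Finset (EuclideanSpace ℝ (Fin s))} (hS : IsPosOrthogonal γ δ S) (hcard : S.card < s) :
    ∃ S', IsPosOrthogonal γ δ S' ∧ S'.card = S.card + 1 := by
  classical
  obtain ⟨z, hz, hz0⟩ : ∃ z ∈ (Submodule.span ℝ (S : Set (EuclideanSpace ℝ (Fin s))))ᗮ, z ≠ 0 := by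
    rw [← Submodule.ne_bot_iff, Ne, Submodule.orthogonal_eq_bot_iff]
    intro htop
    have := finrank_span_finset_le_card (R := ℝ) S
    rw [Set.finrank, htop, finrank_top, finrank_euclideanSpace_fin] at this
    omega
  have hzS (x) (hx : x ∈ S) : inner ℝ z x = 0 :=
    (Submodule.mem_orthogonal' _ _).mp hz x (Submodule.subset_span hx)
  by_cases hall : ∀ x ∈ S, realComb γ z * projMatrix (matrixImage (realComb γ x)) = 0
  · obtain ⟨p, q, hp, hq, hpq, h0, -⟩ := h.exists_sub_isPosPair hA.1 z
    have hort (x) (hx : x ∈ S) : inner ℝ p x = 0 ∧ inner ℝ q x = 0 := by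
      apply h.inner_eq_zero_of_sub_mul h0
      rw [← hpq, ← projMatrix_image_mul (realComb γ x), ← Matrix.mul_assoc, hall x hx,
        Matrix.zero_mul]
    by_cases hp0 : p = 0
    · refine ⟨_, hS.insert hq (fun hq0 => hz0 ?_) fun x hx => (hort x hx).2⟩
      rw [hpq, hp0, hq0, sub_zero]
    · exact ⟨_, hS.insert hp hp0 fun x hx => (hort x hx).1⟩
  · push Not at hall
    obtain ⟨x, hxS, hzx⟩ := hall
    have hx := hS.isPosPair x hxS
    have hVV := projMatrix_mul_self (matrixImage (realComb γ x))
    obtain ⟨-, w, hw⟩ := h.exists_mul_eq_realComb (h.splits hA hx) (projMatrix_isHermitian _)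
      (projMatrix_isHermitian _) hVV (projMatrix_mul_self _) z
    have hVX := projMatrix_image_mul (realComb γ x)
    obtain ⟨Z, hZ⟩ := exists_projMatrix_image_eq_mul (realComb γ x)
    have hVH := projMatrix_isHermitian (matrixImage (realComb γ x))
    set V := projMatrix (matrixImage (realComb γ x))
    have hXH := realComb_isHermitian h.left_hermitian x
    obtain ⟨p, q, hp, hq, hpq, h0, -⟩ := h.exists_sub_isPosPair hA.1 w
    have hwx : inner ℝ w x = 0 := by
      have e := trace_realComb_mul_realComb h.left_orthonormal h.left_hermitian w x
      rw [← hw, Matrix.mul_assoc, hVX,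
        trace_realComb_mul_realComb h.left_orthonormal h.left_hermitian, hzS x hxS] at e
      exact Complex.ofReal_eq_zero.mp (by rw [← e, Complex.ofReal_zero])
    -- A compression that is annihilated by `x` vanishes, since it is supported on `V = X Z`.
    have hne : realComb γ w * realComb γ x ≠ 0 := by
      intro he
      apply hzx
      calc realComb γ z * V = realComb γ w * V := by rw [← hw, Matrix.mul_assoc, hVV]
        _ = 0 := by rw [hZ, ← Matrix.mul_assoc, he, Matrix.zero_mul]
    have hp0 : p ≠ 0 := by
      rintro rfl
      rw [zero_sub] at hpq
      apply hne
      rw [hpq, inner_neg_left, neg_eq_zero] at hwx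
      rw [hpq, map_neg, Matrix.neg_mul, (h.mul_eq_zero_of_inner hq hx hwx).1, neg_zero]
    have hq0 : q ≠ 0 := by
      rintro rfl
      rw [sub_zero] at hpq
      apply hne
      rw [hpq] at hwx ⊢
      exact (h.mul_eq_zero_of_inner hp hx hwx).1
    have hort (y) (hy : y ∈ S.erase x) : inner ℝ p y = 0 ∧ inner ℝ q y = 0 := by
      apply h.inner_eq_zero_of_sub_mul h0
      have hxy := (h.mul_eq_zero_of_inner hx (hS.isPosPair y (Finset.mem_of_mem_erase hy))
        (hS.orthogonal x hxS y (Finset.mem_of_mem_erase hy) (Finset.ne_of_mem_erase hy).symm)).1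
      have hVy : V * realComb γ y = 0 := by
        rw [← hVH.eq, hZ, conjTranspose_mul, hXH.eq, Matrix.mul_assoc, hxy, Matrix.mul_zero]
      rw [← hpq, ← hw, Matrix.mul_assoc, hVy, Matrix.mul_zero]
    obtain ⟨h1, c1⟩ := (hS.erase x).insert hq hq0 fun y hy => (hort y hy).2
    obtain ⟨h2, c2⟩ := h1.insert hp hp0 fun y hy => by
      rcases Finset.mem_insert.mp hy with rfl | hy
      · exact h.inner_eq_zero_of_mul h0
      · exact (hort y hy).1
    exact ⟨_, h2, by rw [c2, c1, Finset.card_erase_add_one hxS]⟩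

/-- The coefficient space has an orthonormal basis of vectors with positive semidefinite
combinations. -/
theorem IsTopSchmidt.exists_orthonormalBasis (h : IsTopSchmidt A L γ δ) (hA : IsPPT A) :
    ∃ u : OrthonormalBasis (Fin s) ℝ (EuclideanSpace ℝ (Fin s)), ∀ i, IsPosPair γ δ (u i) := by
  have hex (r : ℕ) (hr : r ≤ s) : ∃ S, IsPosOrthogonal γ δ S ∧ S.card = r := by
    induction r with
    | zero => exact ⟨∅, ⟨by simp, by simp, by simp⟩, rfl⟩
    | succ r ih =>
      obtain ⟨S, hS, hc⟩ := ih (by omega)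
      rw [← hc]
      exact h.exists_isPosOrthogonal_succ hA hS (by omega)
  obtain ⟨S, hS, hc⟩ := hex s le_rfl
  let e : Fin s ≃ S := (S.equivFinOfCardEq hc).symm
  let v : Fin s → EuclideanSpace ℝ (Fin s) := fun i => (‖(e i).1‖)⁻¹ • (e i).1
  have hn (i) : 0 < ‖(e i).1‖ := norm_pos_iff.mpr (hS.ne_zero _ (e i).2)
  have hv : Orthonormal ℝ v := by
    constructor
    · intro i
      rw [norm_smul, norm_inv, norm_norm, inv_mul_cancel₀ (hn i).ne']
    · intro i j hij
      rw [real_inner_smul_left, real_inner_smul_right, hS.orthogonal _ (e i).2 _ (e j).2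
        (Subtype.coe_ne_coe.mpr (e.injective.ne hij))]
      simp
  have hspan : ⊤ ≤ Submodule.span ℝ (Set.range v) := by
    rw [hv.linearIndependent.span_eq_top_of_card_eq_finrank' (by simp)]
  refine ⟨OrthonormalBasis.mk hv hspan, fun i => ?_⟩
  have hpos := hS.isPosPair _ (e i).2
  have hc : (0 : ℝ) ≤ ‖(e i).1‖⁻¹ := (inv_pos.mpr (hn i)).le
  rw [OrthonormalBasis.coe_mk]
  exact ⟨by rw [map_smul]; exact hpos.1.smul hc, by rw [map_smul]; exact hpos.2.smul hc⟩

end Basis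

/-! ### Uniqueness -/

section Uniqueness

variable {k m s : ℕ} {D : Matrix (Fin k × Fin m) (Fin k × Fin m) ℂ}

/-- Contracting `D` with `αⱼ` on the first factor, computed in both decompositions. -/
theorem IsHermitianSchmidt.coeff_smul_right {r s : ℕ} {μ : Fin r → ℝ} {lam : Fin s → ℝ}
    {α : Fin r → Matrix (Fin k) (Fin k) ℂ} {β : Fin r → Matrix (Fin m) (Fin m) ℂ}
    {γ : Fin s → Matrix (Fin k) (Fin k) ℂ} {δ : Fin s → Matrix (Fin m) (Fin m) ℂ}
    (h : IsHermitianSchmidt D μ α β) (h' : IsHermitianSchmidt D lam γ δ) (j : Fin r) :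
    (μ j : ℂ) • β j = ∑ i, ((lam i : ℂ) * (γ i * α j).trace) • δ i := by
  rw [ext_iff_trace_mul_right]
  intro Y
  have e := (h.trace_mul_kronecker (α j) Y).symm.trans (h'.trace_mul_kronecker (α j) Y)
  rw [Finset.sum_eq_single j] at e
  · simpa [h.left_orthonormal.trace_mul h.left_hermitian, Finset.sum_mul, trace_sum, mul_assoc]
      using e
  · intro i _ hij
    simp [h.left_orthonormal.trace_mul h.left_hermitian, hij]
  · simp

/-- Contracting `D` with `βⱼ` on the second factor, computed in both decompositions. -/
theorem IsHermitianSchmidt.coeff_smul_left {r s : ℕ} {μ : Fin r → ℝ} {lam : Fin s → ℝ}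
    {α : Fin r → Matrix (Fin k) (Fin k) ℂ} {β : Fin r → Matrix (Fin m) (Fin m) ℂ}
    {γ : Fin s → Matrix (Fin k) (Fin k) ℂ} {δ : Fin s → Matrix (Fin m) (Fin m) ℂ}
    (h : IsHermitianSchmidt D μ α β) (h' : IsHermitianSchmidt D lam γ δ) (j : Fin r) :
    (μ j : ℂ) • α j = ∑ i, ((lam i : ℂ) * (δ i * β j).trace) • γ i := by
  rw [ext_iff_trace_mul_right]
  intro X
  have e := (h.trace_mul_kronecker X (β j)).symm.trans (h'.trace_mul_kronecker X (β j))
  rw [Finset.sum_eq_single j] at e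
  · simpa [h.right_orthonormal.trace_mul h.right_hermitian, Finset.sum_mul, trace_sum, mul_assoc,
      mul_comm, mul_left_comm] using e
  · intro i _ hij
    simp [h.right_orthonormal.trace_mul h.right_hermitian, hij]
  · simp

/-- Two Schmidt decompositions into positive semidefinite terms, one of them with all coefficients
equal to `1`, agree up to order. The matrix `(tr (γᵢ αⱼ))` of coefficients relating them is
orthogonal with nonnegative entries, hence a permutation matrix. -/
theorem IsHermitianSchmidt.exists_equiv_of_posSemidef {r : ℕ} {μ : Fin r → ℝ}
    {α : Fin r → Matrix (Fin k) (Fin k) ℂ} {β : Fin r → Matrix (Fin m) (Fin m) ℂ}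
    {γ : Fin s → Matrix (Fin k) (Fin k) ℂ} {δ : Fin s → Matrix (Fin m) (Fin m) ℂ}
    (h : IsHermitianSchmidt D μ α β) (h' : IsHermitianSchmidt D (fun _ => 1) γ δ)
    (hα : ∀ j, (α j).PosSemidef) (hγ : ∀ i, (γ i).PosSemidef) :
    ∃ σ : Fin r ≃ Fin s, ∀ j, μ j = 1 ∧ α j = γ (σ j) ∧ β j = δ (σ j) := by
  have tα := h.left_orthonormal.trace_mul h.left_hermitian
  have tβ := h.right_orthonormal.trace_mul h.right_hermitian
  have tγ := h'.left_orthonormal.trace_mul h'.left_hermitian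
  have tδ := h'.right_orthonormal.trace_mul h'.right_hermitian
  have hβ1 (j) : (μ j : ℂ) • β j = ∑ i, (γ i * α j).trace • δ i := by
    simpa using h.coeff_smul_right h' j
  have hα1 (j) : (μ j : ℂ) • α j = ∑ i, (δ i * β j).trace • γ i := by
    simpa using h.coeff_smul_left h' j
  have hab (j i) : (μ j : ℂ) * (δ i * β j).trace = (γ i * α j).trace := by
    have := congrArg (fun M => (δ i * M).trace) (hβ1 j)
    simpa [Finset.mul_sum, trace_sum, tδ] using this
  have hba (j i) : (μ j : ℂ) * (γ i * α j).trace = (δ i * β j).trace := by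
    have := congrArg (fun M => (γ i * M).trace) (hα1 j)
    simpa [Finset.mul_sum, trace_sum, tγ] using this
  have hex (j) : ∃ i, (γ i * α j).trace ≠ 0 := by
    by_contra! hall
    have := congrArg (fun M => (M * β j).trace) (hβ1 j)
    simp [hall, tβ, (h.lam_pos j).ne'] at this
  have hμ (j) : μ j = 1 := by
    obtain ⟨i, hi⟩ := hex j
    have h1 : ((μ j : ℂ) * μ j) * (γ i * α j).trace = 1 * (γ i * α j).trace := by
      rw [mul_assoc, hba, hab, one_mul]
    have h2 : μ j * μ j = 1 := by exact_mod_cast mul_right_cancel₀ hi h1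
    nlinarith [h.lam_pos j]
  have hβ2 (j) : β j = ∑ i, (γ i * α j).trace • δ i := by simpa [hμ] using hβ1 j
  have hα2 (j) : α j = ∑ i, (γ i * α j).trace • γ i := by
    have := hα1 j
    simp only [← hba, hμ] at this
    simpa using this
  have hγ2 (i) : γ i = ∑ j, (γ i * α j).trace • α j := by
    have := h'.coeff_smul_left h i
    simp only [hμ, trace_mul_comm (β _), ← hba] at this
    simpa using this
  have hnn (i j) : 0 ≤ (γ i * α j).trace := (hγ i).trace_mul_nonneg (hα j)
  have hrow (j i i') (hi : i ≠ i') : (γ i * α j).trace * (γ i' * α j).trace = 0 := by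
    have := congrArg (fun M => (γ i' * M).trace) (hγ2 i)
    simp only [Finset.mul_sum, trace_sum, mul_smul_comm, trace_smul, smul_eq_mul, tγ, hi.symm,
      if_false] at this
    exact (Finset.sum_eq_zero_iff_of_nonneg fun j _ => mul_nonneg (hnn i j) (hnn i' j)).mp
      this.symm j (Finset.mem_univ j)
  have hcol (i j j') (hj : j ≠ j') : (γ i * α j).trace * (γ i * α j').trace = 0 := by
    have := congrArg (fun M => (M * α j').trace) (hα2 j)
    simp only [Finset.sum_mul, trace_sum, smul_mul_assoc, trace_smul, smul_eq_mul, tα, hj,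
      if_false] at this
    exact (Finset.sum_eq_zero_iff_of_nonneg fun i _ => mul_nonneg (hnn i j) (hnn i j')).mp
      this.symm i (Finset.mem_univ i)
  choose σ hσ using hex
  have hzero (j i) (hi : i ≠ σ j) : (γ i * α j).trace = 0 :=
    (mul_eq_zero.mp (hrow j i _ hi)).resolve_right (hσ j)
  have hone (j) : (γ (σ j) * α j).trace = 1 := by
    have := congrArg (fun M => (M * α j).trace) (hα2 j)
    simp only [Finset.sum_mul, trace_sum, smul_mul_assoc, trace_smul, smul_eq_mul, tα,
      if_true] at this
    rw [Finset.sum_eq_single (σ j) (fun i _ hi => by rw [hzero j i hi, zero_mul]) (by simp)] at this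
    rcases mul_self_eq_one_iff.mp this.symm with h1 | h1
    · exact h1
    · have := hnn (σ j) j
      rw [h1, Complex.le_def] at this
      norm_num at this
  have hinj : Function.Injective σ := by
    intro j j' hj
    by_contra hne
    have := hcol (σ j) j j' hne
    rw [hone, hj, hone] at this
    norm_num at this
  have hsurj : Function.Surjective σ := by
    intro i
    by_contra! hall
    have h0 : γ i = 0 := by
      rw [hγ2 i]
      exact Finset.sum_eq_zero fun j _ => by rw [hzero j i (hall j).symm, zero_smul]
    have := tγ i i
    simp [h0] at this
  refine ⟨Equiv.ofBijective σ ⟨hinj, hsurj⟩, fun j => ⟨hμ j, ?_, ?_⟩⟩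
  · rw [hα2 j, Finset.sum_eq_single (σ j) (fun i _ hi => by rw [hzero j i hi, zero_smul])
      (by simp), hone, one_smul]
    rfl
  · rw [hβ2 j, Finset.sum_eq_single (σ j) (fun i _ hi => by rw [hzero j i hi, zero_smul])
      (by simp), hone, one_smul]
    rfl

end Uniqueness

/-! ### The split decomposition -/

section Main

variable {k m s : ℕ}

/-- An orthogonal change of the coefficient basis does not change `∑ γᵢ ⊗ δᵢ`. -/
theorem sum_realComb_kronecker_realComb (γ : Fin s → Matrix (Fin k) (Fin k) ℂ)
    (δ : Fin s → Matrix (Fin m) (Fin m) ℂ)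
    (u : OrthonormalBasis (Fin s) ℝ (EuclideanSpace ℝ (Fin s))) :
    ∑ i, realComb γ (u i) ⊗ₖ realComb δ (u i) = ∑ i, γ i ⊗ₖ δ i := by
  have hu (a b : Fin s) : ∑ i, (u i a : ℂ) * (u i b : ℂ) = if a = b then 1 else 0 := by
    have h := u.sum_inner_mul_inner (EuclideanSpace.single a 1) (EuclideanSpace.single b 1)
    have h' : ∑ i, u i a * u i b = if a = b then 1 else 0 := by
      simpa [EuclideanSpace.inner_single_left, EuclideanSpace.inner_single_right, eq_comm] using h
    have h'' := congrArg Complex.ofReal h'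
    rwa [Complex.ofReal_sum, apply_ite Complex.ofReal, Complex.ofReal_one, Complex.ofReal_zero,
      Finset.sum_congr rfl fun i _ => Complex.ofReal_mul _ _] at h''
  simp only [realComb_apply, sum_kronecker, kronecker_sum, smul_kronecker, kronecker_smul,
    Finset.smul_sum, smul_smul]
  rw [Finset.sum_comm]
  refine Finset.sum_congr rfl fun a _ => ?_
  rw [Finset.sum_comm]
  simp only [← Finset.sum_smul, hu]
  simp

theorem splitProj_castSucc (X : Fin s → Matrix (Fin k) (Fin k) ℂ) (i : Fin s) :
    splitProj X i.castSucc = projMatrix (matrixImage (X i)) := by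
  simp [splitProj]

theorem splitProj_last (X : Fin s → Matrix (Fin k) (Fin k) ℂ) :
    splitProj X (Fin.last s) = projMatrix (⨆ i, matrixImage (X i))ᗮ := by
  simp [splitProj]

theorem splitProj_isHermitian (X : Fin s → Matrix (Fin k) (Fin k) ℂ) (i : Fin (s + 1)) :
    (splitProj X i).IsHermitian := by
  induction i using Fin.lastCases with
  | last => rw [splitProj_last]; exact projMatrix_isHermitian _
  | cast i => rw [splitProj_castSucc]; exact projMatrix_isHermitian _

theorem splitProj_mul_self (X : Fin s → Matrix (Fin k) (Fin k) ℂ) (i : Fin (s + 1)) :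
    splitProj X i * splitProj X i = splitProj X i := by
  induction i using Fin.lastCases with
  | last => rw [splitProj_last]; exact projMatrix_mul_self _
  | cast i => rw [splitProj_castSucc]; exact projMatrix_mul_self _

end Main

theorem mainTheorem2 {k m n : ℕ} (A : Matrix (Fin k × Fin m) (Fin k × Fin m) ℂ) (hA : IsPPT A)
    (lam : Fin n → ℝ) (γ : Fin n → Matrix (Fin k) (Fin k) ℂ)
    (δ : Fin n → Matrix (Fin m) (Fin m) ℂ) (hdec : IsHermitianSchmidt A lam γ δ)
    (s : ℕ) (hs : 1 ≤ s) (hsn : s ≤ n)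
    (hanti : Antitone lam)
    (heq : ∀ i j : Fin n, (i : ℕ) < s → (j : ℕ) < s → lam i = lam j)
    (hlt : ∀ i j : Fin n, (i : ℕ) < s → s ≤ (j : ℕ) → lam j < lam i)
    (D : Matrix (Fin k × Fin m) (Fin k × Fin m) ℂ)
    (hD : D = ∑ i : Fin s, γ (Fin.castLE hsn i) ⊗ₖ δ (Fin.castLE hsn i)) :
    ∃ (γ' : Fin s → Matrix (Fin k) (Fin k) ℂ) (δ' : Fin s → Matrix (Fin m) (Fin m) ℂ),
      -- existence of the decomposition
      (IsHermitianSchmidt D (fun _ => 1) γ' δ' ∧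
        (∀ i, (γ' i).PosSemidef) ∧ (∀ i, (δ' i).PosSemidef)) ∧
      -- uniqueness, up to the order of the summands
      (∀ (r : ℕ) (μ : Fin r → ℝ) (α : Fin r → Matrix (Fin k) (Fin k) ℂ)
        (β : Fin r → Matrix (Fin m) (Fin m) ℂ), IsHermitianSchmidt D μ α β →
        (∀ j, (α j).PosSemidef) → (∀ j, (β j).PosSemidef) →
        ∃ σ : Fin r ≃ Fin s, ∀ j, μ j = 1 ∧ α j = γ' (σ j) ∧ β j = δ' (σ j)) ∧
      -- the sums of the images are direct
      (iSupIndep (fun i => matrixImage (γ' i)) ∧ iSupIndep (fun i => matrixImage (δ' i))) ∧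
      -- the split decomposition
      A = ∑ i : Fin (s + 1), (splitProj γ' i ⊗ₖ splitProj δ' i) * A *
        (splitProj γ' i ⊗ₖ splitProj δ' i) ∧
      ∀ i : Fin (s + 1), IsPPT ((splitProj γ' i ⊗ₖ splitProj δ' i) * A *
        (splitProj γ' i ⊗ₖ splitProj δ' i)) := by
  set i₀ : Fin n := ⟨0, by omega⟩
  have h : IsTopSchmidt A (lam i₀) (γ ∘ Fin.castLE hsn) (δ ∘ Fin.castLE hsn) :=
    hdec.isTopSchmidt hsn (hdec.lam_pos i₀) (fun i hi => heq i i₀ hi hs)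
      fun i hi => hlt i₀ i hs hi
  obtain ⟨u, hu⟩ := h.exists_orthonormalBasis hA
  set γ' : Fin s → Matrix (Fin k) (Fin k) ℂ := fun i => realComb (γ ∘ Fin.castLE hsn) (u i)
  set δ' : Fin s → Matrix (Fin m) (Fin m) ℂ := fun i => realComb (δ ∘ Fin.castLE hsn) (u i)
  have hγ' (i) : (γ' i).IsHermitian := (hu i).1.isHermitian
  have hδ' (i) : (δ' i).IsHermitian := (hu i).2.isHermitian
  have hD' : IsHermitianSchmidt D (fun _ => 1) γ' δ' := by
    refine ⟨fun _ => one_pos, hγ', hδ', fun i j => ?_, fun i j => ?_, ?_⟩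
    · rw [(hγ' j).eq, trace_realComb_mul_realComb h.left_orthonormal h.left_hermitian,
        orthonormal_iff_ite.mp u.orthonormal]
      split_ifs <;> simp
    · rw [(hδ' j).eq, trace_realComb_mul_realComb h.right_orthonormal h.right_hermitian,
        orthonormal_iff_ite.mp u.orthonormal]
      split_ifs <;> simp
    · rw [hD]
      simpa using (sum_realComb_kronecker_realComb (γ ∘ Fin.castLE hsn) (δ ∘ Fin.castLE hsn) u).symm
  have hort (i j : Fin s) (hij : i ≠ j) : γ' i * γ' j = 0 ∧ δ' i * δ' j = 0 :=
    h.mul_eq_zero_of_inner (hu i) (hu j) (u.orthonormal.2 hij)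
  have hsplit (i : Fin s) :
      Splits A (projMatrix (matrixImage (γ' i))) (projMatrix (matrixImage (δ' i))) :=
    h.splits hA (hu i)
  have hV := projMatrix_iSup_orthogonal hγ' fun i j hij => (hort i j hij).1
  have hW := projMatrix_iSup_orthogonal hδ' fun i j hij => (hort i j hij).2
  have hsplit' (i : Fin (s + 1)) : Splits A (splitProj γ' i) (splitProj δ' i) := by
    induction i using Fin.lastCases with
    | last =>
      rw [splitProj_last, splitProj_last, hV, hW]
      exact Splits.one.sub (Splits.sum hsplit)
    | cast i =>
      rw [splitProj_castSucc, splitProj_castSucc]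
      exact hsplit i
  have hsum : ∑ i, splitProj γ' i = 1 := by
    rw [Fin.sum_univ_castSucc, splitProj_last, hV]
    simp only [splitProj_castSucc]
    exact add_sub_cancel _ _
  refine ⟨γ', δ', ⟨hD', fun i => (hu i).1, fun i => (hu i).2⟩,
    fun r μ α β hαβ hα _ => hαβ.exists_equiv_of_posSemidef hD' hα fun i => (hu i).1,
    ⟨iSupIndep_matrixImage hγ' fun i j hij => (hort i j hij).1,
      iSupIndep_matrixImage hδ' fun i j hij => (hort i j hij).2⟩, ?_,
    fun i => hA.kronecker_mul_mul (splitProj_isHermitian γ' i) (splitProj_isHermitian δ' i)⟩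
  -- Each term of the sum is `A (Vᵢ ⊗ 1)`, and the `Vᵢ` add up to the identity.
  simp only [(hsplit' _).compress (splitProj_mul_self γ' _)]
  rw [← Finset.mul_sum, ← sum_kronecker, hsum, one_kronecker_one, Matrix.mul_one]
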